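/- Let $k$ be a field, $R=k[x_1,\dots,x_n]$ with its standard grading, and $\mathfrak m=(x_1,\dots,x_n)$. For an ideal $\mathfrak a\subseteq R$ and $s\ge 0$ let $\mathfrak a^{(s)}=\bigcap_{\mathfrak p\in\operatorname{Ass}(R/\mathfrak a)}(\mathfrak a^sR_{\mathfrak p}\cap R)$ be its $s$-th symbolic power, let $\mathcal R_s(\mathfrak a)=\bigoplus_{s\ge0}\mathfrak a^{(s)}T^s\subseteq R[T]$ be its symbolic Rees algebra, let $\overline{\mathfrak a}$ be its integral closure, and, for $\mathfrak a\ne0$, let $\alpha(\mathfrak a)$ be the least degree of a non-zero element of $\mathfrak a$ and $\widehat\alpha(\mathfrak a)=\lim_{s\to\infty}\alpha(\mathfrak a^{(s)})/s$ its Waldschmidt constant. For families of ideals $\mathfrak a_\bullet=\{\mathfrak a_i\}_{i\ge1}$ and $\mathfrak b_\bullet=\{\mathfrak b_i\}_{i\ge1}$ let $$\widehat\rho(\mathfrak a_\bullet,\mathfrak b_\bullet)=\sup\Big\{\tfrac sr : s,r\ge1 \text{ integers},\ \mathfrak a_{sk}\not\subseteq\mathfrak b_{rk}\text{ for all sufficiently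 large }k\Big\}.$$ Let $\mathfrak a_1,\dots,\mathfrak a_m$ be non-zero proper homogeneous ideals of $R$ and let $N\ge0$ be an integer such that (P1) for all $1\le t\le m$, $\mathcal R_s(\mathfrak a_t)=R[\mathfrak a_tT,\mathfrak a_{t+1}T^2,\dots,\mathfrak a_mT^{m-t+1}]$; (P2) for all $0\le t\le m-1$, $\alpha(\mathfrak a_{t+1})=\alpha(\mathfrak a_1)+t$; (P3) $\mathfrak a_1$ is generated by linear forms and, for all $1\le t\le m$ and $s\ge1$, $$\overline{(\mathfrak m^N\mathfrak a_t)^s}=\mathfrak a_1^{Ns+ts}\cap\bigcap_{j=2}^t\mathfrak a_j^{(s(t-j+1))}.$$ Then, for all $1\le t\le m$, the limit defining $\widehat\alpha(\mathfrak a_t)$ exists, and, with $\mathfrak a_t^{(\bullet)}=\{\mathfrak a_t^{(i)}\}_{i\ge1}$ and $(\mathfrak m^N\mathfrak a_t)^\bullet=\{(\mathfrak m^N\mathfrak a_t)^i\}_{i\ge1}$, $$\widehat\rho\big(\mathfrak a_t^{(\bullet)},(\mathfrak m^N\mathfrak a_t)^\bullet\big)=\frac{N+\alpha(\mathfrak a_t)}{\widehat\alpha(\mathfrak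 a_t)}=\frac{(N+t)(m-t+1)}{m}.$$ -/

import Mathlib

open Filter

attribute [local instance] MvPolynomial.gradedAlgebra

/-- The `n`-th symbolic power `I^(n)` of an ideal `I`: the intersection, over the associated
primes `p` of `R ⧸ I`, of the contractions `I ^ n R_p ∩ R`. -/
noncomputable def symbolicPower {R : Type*} [CommRing R] (I : Ideal R) (n : ℕ) : Ideal R :=
  ⨅ (p : Ideal R) (hp : p ∈ associatedPrimes R (R ⧸ I)),
    haveI : p.IsPrime := hp.1
    ((I ^ n).map (algebraMap R (Localization.AtPrime p))).comap
      (algebraMap R (Localization.AtPrime p))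

theorem mem_symbolicPower_iff {R : Type*} [CommRing R] (I : Ideal R) (n : ℕ) (f : R) :
    f ∈ symbolicPower I n ↔ ∀ (p : Ideal R) (hp : p ∈ associatedPrimes R (R ⧸ I)),
      haveI : p.IsPrime := hp.1
      algebraMap R (Localization.AtPrime p) f ∈
        (I ^ n).map (algebraMap R (Localization.AtPrime p)) := by
  simp only [symbolicPower, Ideal.mem_iInf, Ideal.mem_comap]

theorem symbolicPower_zero {R : Type*} [CommRing R] (I : Ideal R) : symbolicPower I 0 = ⊤ := by
  rw [Ideal.eq_top_iff_one, mem_symbolicPower_iff]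
  intro p hp
  simp [Ideal.one_eq_top, Ideal.map_top]

theorem mul_mem_symbolicPower_add {R : Type*} [CommRing R] (I : Ideal R) {i j : ℕ} {f g : R}
    (hf : f ∈ symbolicPower I i) (hg : g ∈ symbolicPower I j) :
    f * g ∈ symbolicPower I (i + j) := by
  rw [mem_symbolicPower_iff] at *
  intro p hp
  rw [map_mul, pow_add, Ideal.map_mul]
  exact Ideal.mul_mem_mul (hf p hp) (hg p hp)

/-- The symbolic Rees algebra `⨁ₙ I^(n) Tⁿ`, as a subalgebra of `R[T]`. -/
noncomputable def symbolicReesAlgebra {R : Type*} [CommRing R] (I : Ideal R) :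
    Subalgebra R (Polynomial R) where
  carrier := {f | ∀ i, f.coeff i ∈ symbolicPower I i}
  mul_mem' {f g} hf hg i := by
    rw [Polynomial.coeff_mul]
    apply Ideal.sum_mem
    rintro ⟨j, k⟩ e
    rw [← Finset.HasAntidiagonal.mem_antidiagonal.mp e]
    exact mul_mem_symbolicPower_add I (hf j) (hg k)
  add_mem' {f g} hf hg i := by
    rw [Polynomial.coeff_add]
    exact Ideal.add_mem _ (hf i) (hg i)
  algebraMap_mem' r i := by
    rw [Polynomial.algebraMap_apply, Polynomial.coeff_C]
    split_ifs with h
    · subst h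
      rw [symbolicPower_zero]
      exact Submodule.mem_top
    · exact Ideal.zero_mem _

/-- The subalgebra `R[a_t T, a_{t+1} T², …, a_m T^{m-t+1}]` of `R[T]`. -/
noncomputable def shiftedReesAlgebra {R : Type*} [CommRing R] (a : ℕ → Ideal R) (t m : ℕ) :
    Subalgebra R (Polynomial R) :=
  Algebra.adjoin R {g | ∃ j, t ≤ j ∧ j ≤ m ∧ ∃ f ∈ a j, g = Polynomial.monomial (j - t + 1) f}

/-- The integral closure of an ideal `I`: the elements `x` satisfying an equation
`x ^ d + c₁ x ^ (d - 1) + ⋯ + c_d = 0` with `d ≥ 1` and `c_i ∈ I ^ i`. -/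
def idealIntegralClosure {R : Type*} [CommRing R] (I : Ideal R) : Set R :=
  {x | ∃ d : ℕ, 0 < d ∧ ∃ c : ℕ → R, (∀ i ∈ Finset.Icc 1 d, c i ∈ I ^ i) ∧
    x ^ d + ∑ i ∈ Finset.Icc 1 d, c i * x ^ (d - i) = 0}

/-- The asymptotic resurgence of a pair of families of ideals: the supremum, in the extended
reals, of the `s / r` (`s, r ≥ 1`) with `a_{sk} ⊄ b_{rk}` for all sufficiently large `k`. -/
noncomputable def asymptoticResurgence {R : Type*} [CommRing R] (a b : ℕ → Ideal R) : EReal :=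
  sSup {x : EReal | ∃ s r : ℕ, 0 < s ∧ 0 < r ∧ (∀ᶠ k : ℕ in atTop, ¬ a (s * k) ≤ b (r * k)) ∧
    x = (((s : ℝ) / (r : ℝ) : ℝ) : EReal)}

/-- `α(I)`: the least degree of a non-zero element of an ideal `I ≠ 0` of a polynomial ring. -/
noncomputable def initialDegree {k σ : Type*} [Field k] (I : Ideal (MvPolynomial σ k)) : ℕ :=
  sInf {d | ∃ f ∈ I, f ≠ 0 ∧ f.totalDegree = d}

/-- The Waldschmidt constant `lim α(I^(s)) / s`. -/
noncomputable def waldschmidtConstant {k σ : Type*} [Field k]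
    (I : Ideal (MvPolynomial σ k)) : ℝ :=
  limUnder atTop (fun s : ℕ => (initialDegree (symbolicPower I s) : ℝ) / (s : ℝ))

/-- The homogeneous maximal ideal, generated by the variables. -/
noncomputable def irrelevantIdeal (k σ : Type*) [Field k] : Ideal (MvPolynomial σ k) :=
  Ideal.span (Set.range MvPolynomial.X)

/-- An ideal that is generated by linear forms. -/
def IsGeneratedByLinearForms {k σ : Type*} [Field k] (I : Ideal (MvPolynomial σ k)) : Prop :=
  ∃ S : Set (MvPolynomial σ k), (∀ f ∈ S, f.IsHomogeneous 1) ∧ I = Ideal.span S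

/-! Put b = m - t + 1 and I = 𝔪^N a_t. As α(a_1) = 1, (P2) gives α(a_i) = i. By (P1), a_t^(s) is the
sum of the products ∏ a_i^(e_i), t ≤ i ≤ m, with ∑ e_i (i - t + 1) = s. Since i / (i - t + 1) does
not increase with i, such products have degree at least ms/b, and powers of a_m attain this up to a
bounded error, so the Waldschmidt constant is m/b (`mul_le_initialDegree_symbolicPower`,
`exists_mem_symbolicPower_totalDegree_le`).

Non-containment is a degree count, because I^r ⊆ 𝔪^((N+t)r). For containment, (P3) puts a_i^E, with
E = (N+t)b, into the integral closure of I^(m(i-t+1)). Removing the closure costs only a bounded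
shift (`Ideal.FG.exists_pow_le_of_subset_idealIntegralClosure`), as does passing to products
(`exists_symbolicPower_le_pow`), and bounded shifts do not change the asymptotic resurgence
(`asymptoticResurgence_eq`). -/

/-! ### Symbolic powers as a graded family. -/

theorem symbolicPower_antitone {R : Type*} [CommRing R] (I : Ideal R) :
    Antitone (symbolicPower I) := by
  intro i j hij f hf
  rw [mem_symbolicPower_iff] at *
  intro p hp
  exact Ideal.map_mono (Ideal.pow_le_pow_right hij) (hf p hp)

theorem symbolicPower_mul_le {R : Type*} [CommRing R] (I : Ideal R) (i j : ℕ) :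
    symbolicPower I i * symbolicPower I j ≤ symbolicPower I (i + j) :=
  Ideal.mul_le.mpr fun _ hf _ hg => mul_mem_symbolicPower_add I hf hg

theorem symbolicPower_pow_le {R : Type*} [CommRing R] (I : Ideal R) (i e : ℕ) :
    symbolicPower I i ^ e ≤ symbolicPower I (i * e) := by
  induction e with
  | zero => simp [symbolicPower_zero]
  | succ e ih =>
    rw [pow_succ, Nat.mul_succ]
    exact (Ideal.mul_mono_left ih).trans (symbolicPower_mul_le I _ _)

/-- If the symbolic Rees algebra is generated by `a_t T, …, a_m T^{m-t+1}`, then every graded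
family of ideals containing these generators contains all the symbolic powers. -/
theorem symbolicPower_le_of_symbolicReesAlgebra_eq {R : Type*} [CommRing R] {a : ℕ → Ideal R}
    {t m : ℕ} (h : symbolicReesAlgebra (a t) = shiftedReesAlgebra a t m) (F : ℕ → Ideal R)
    (hF0 : F 0 = ⊤) (hFmul : ∀ i j, F i * F j ≤ F (i + j))
    (hFa : ∀ j, t ≤ j → j ≤ m → a j ≤ F (j - t + 1)) (s : ℕ) :
    symbolicPower (a t) s ≤ F s := by
  have key : ∀ g ∈ shiftedReesAlgebra a t m, ∀ i, g.coeff i ∈ F i := by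
    intro g hg
    induction hg using Algebra.adjoin_induction with
    | mem g hg =>
      obtain ⟨j, htj, hjm, f, hf, rfl⟩ := hg
      intro i
      rw [Polynomial.coeff_monomial]
      split_ifs with hi
      · exact hi ▸ hFa j htj hjm hf
      · exact zero_mem _
    | algebraMap r =>
      intro i
      rw [Polynomial.algebraMap_apply, Polynomial.coeff_C]
      split_ifs with hi
      · simp [hi, hF0]
      · exact zero_mem _
    | add f g _ _ hf hg =>
      intro i
      rw [Polynomial.coeff_add]
      exact add_mem (hf i) (hg i)
    | mul f g _ _ hf hg =>
      intro i
      rw [Polynomial.coeff_mul]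
      refine sum_mem fun e he => ?_
      rw [← Finset.HasAntidiagonal.mem_antidiagonal.mp he]
      exact hFmul _ _ (Ideal.mul_mem_mul (hf _) (hg _))
  intro f hf
  have hmem : Polynomial.monomial s f ∈ symbolicReesAlgebra (a t) := by
    intro i
    rw [Polynomial.coeff_monomial]
    split_ifs with hi
    · exact hi ▸ hf
    · exact zero_mem _
  have := key _ (h ▸ hmem) s
  rwa [Polynomial.coeff_monomial, if_pos rfl] at this

theorem le_symbolicPower_of_symbolicReesAlgebra_eq {R : Type*} [CommRing R] {a : ℕ → Ideal R}
    {t m : ℕ} (h : symbolicReesAlgebra (a t) = shiftedReesAlgebra a t m) {j : ℕ}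
    (htj : t ≤ j) (hjm : j ≤ m) : a j ≤ symbolicPower (a t) (j - t + 1) := by
  intro f hf
  have hmem : Polynomial.monomial (j - t + 1) f ∈ shiftedReesAlgebra a t m :=
    Algebra.subset_adjoin ⟨j, htj, hjm, f, hf, rfl⟩
  rw [← h] at hmem
  simpa using hmem (j - t + 1)

/-! ### Integral closure and powers. -/

theorem le_idealIntegralClosure {R : Type*} [CommRing R] (I : Ideal R) :
    (I : Set R) ⊆ idealIntegralClosure I := fun x hx =>
  ⟨1, one_pos, fun _ => -x, by simpa using hx, by simp⟩

/-- The integral equation of degree d rewrites x^n through lower powers, so the loss never exceeds d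
- 1. -/
theorem exists_pow_mem_of_mem_idealIntegralClosure {R : Type*} [CommRing R] {K : Ideal R} {x : R}
    (hx : x ∈ idealIntegralClosure K) : ∃ c, ∀ n, x ^ n ∈ K ^ (n - c) := by
  obtain ⟨d, hd, c, hc, h⟩ := hx
  refine ⟨d - 1, fun n => ?_⟩
  induction n using Nat.strong_induction_on with
  | _ n ih =>
    rcases lt_or_ge n d with hn | hn
    · simp [show n - (d - 1) = 0 by omega]
    · have hxd : x ^ n = -∑ i ∈ Finset.Icc 1 d, c i * x ^ (n - i) := by
        rw [show x ^ n = x ^ d * x ^ (n - d) by rw [← pow_add, Nat.add_sub_cancel' hn],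
          eq_neg_of_add_eq_zero_left h, neg_mul, Finset.sum_mul]
        congr 1
        refine Finset.sum_congr rfl fun i hi => ?_
        rw [Finset.mem_Icc] at hi
        rw [mul_assoc, ← pow_add, show d - i + (n - d) = n - i by omega]
      rw [hxd]
      refine neg_mem (sum_mem fun i hi => ?_)
      have hi' := Finset.mem_Icc.mp hi
      have := Ideal.mul_mem_mul (hc i hi) (ih (n - i) (by omega))
      rw [← pow_add] at this
      exact Ideal.pow_le_pow_right (by omega) this

/-- A finitely generated ideal whose elements are integral over `K` has its powers in those of `K`,
up to a bounded shift. -/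
theorem Ideal.FG.exists_pow_le_of_subset_idealIntegralClosure {R : Type*} [CommRing R]
    {J K : Ideal R} (hJ : J.FG) (h : (J : Set R) ⊆ idealIntegralClosure K) :
    ∃ c, ∀ n, J ^ n ≤ K ^ (n - c) := by
  induction J, hJ using Submodule.fg_induction with
  | singleton x =>
    obtain ⟨c, hc⟩ := exists_pow_mem_of_mem_idealIntegralClosure
      (h (Submodule.mem_span_singleton_self x))
    refine ⟨c, fun n => ?_⟩
    change Ideal.span {x} ^ n ≤ _
    rw [Ideal.span_singleton_pow, Ideal.span_singleton_le_iff_mem]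
    exact hc n
  | sup J₁ J₂ _ _ ih₁ ih₂ =>
    obtain ⟨c₁, h₁⟩ := ih₁ fun x hx => h (Submodule.mem_sup_left hx)
    obtain ⟨c₂, h₂⟩ := ih₂ fun x hx => h (Submodule.mem_sup_right hx)
    refine ⟨c₁ + c₂, fun n => ?_⟩
    rw [← Submodule.add_eq_sup, add_pow, Ideal.sum_eq_sup]
    refine Finset.sup_le fun i hi => ?_
    rw [Finset.mem_range] at hi
    -- The binomial coefficient is dropped; the two factors lose at most c₁ and c₂.
    refine Ideal.mul_le_left.trans ((Ideal.mul_mono (h₁ i) (h₂ (n - i))).trans ?_)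
    rw [← pow_add]
    exact Ideal.pow_le_pow_right (by omega)

/-- If every `a_i` (`t ≤ i ≤ m`) has its powers contained in those of `I` at the linear rate
`(i - t + 1) * p / q`, up to a bounded shift, then the symbolic powers of `a_t` are contained in
the powers of `I` at the rate `p / q`, up to a bounded shift. -/
theorem exists_symbolicPower_le_pow {R : Type*} [CommRing R] {a : ℕ → Ideal R} {t m : ℕ}
    (h : symbolicReesAlgebra (a t) = shiftedReesAlgebra a t m) (I : Ideal R) (p : ℕ) {q : ℕ}
    (hq : 0 < q) (ha : ∀ i, t ≤ i → i ≤ m →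
      ∃ C, ∀ e, ∃ r, p * (i - t + 1) * e ≤ q * r + C ∧ a i ^ e ≤ I ^ r) :
    ∃ C, ∀ s r, q * r + C ≤ p * s → symbolicPower (a t) s ≤ I ^ r := by
  choose! C r hr using ha
  set T := Finset.Icc t m with hT
  -- Each index i enters a product once, as the whole power `a i ^ e i`, so its shift is paid once
  -- whatever `s` is.
  refine ⟨∑ i ∈ T, C i, fun s r' hs => ?_⟩
  refine (symbolicPower_le_of_symbolicReesAlgebra_eq h
    -- This graded family consists of the sums of products of weight `s`, where `a i` has weight i -
    -- t + 1.
    (fun s => ⨆ (e : ℕ → ℕ) (_ : ∑ i ∈ T, e i * (i - t + 1) = s), ∏ i ∈ T, a i ^ e i)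
    ?_ ?_ ?_ s).trans ?_
  · rw [eq_top_iff]
    exact le_iSup₂_of_le 0 (by simp) (by simp)
  · intro i j
    simp only [Ideal.mul_iSup, Ideal.iSup_mul, iSup_le_iff]
    intro e he f hf
    refine le_iSup₂_of_le (e + f) ?_ ?_
    · simp only [Pi.add_apply, add_mul, Finset.sum_add_distrib]
      omega
    · simp only [Pi.add_apply, pow_add, Finset.prod_mul_distrib]
      exact le_of_eq (mul_comm _ _)
  · intro j htj hjm
    have hj : j ∈ T := Finset.mem_Icc.mpr ⟨htj, hjm⟩
    refine le_iSup₂_of_le (Pi.single j 1) ?_ ?_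
    · rw [Finset.sum_eq_single_of_mem j hj fun i _ hij => by simp [hij]]
      simp
    · rw [Finset.prod_eq_single_of_mem j hj fun i _ hij => by simp [hij]]
      simp
  · refine iSup₂_le fun e he => ?_
    have h1 : ∏ i ∈ T, a i ^ e i ≤ ∏ i ∈ T, I ^ r i (e i) :=
      Finset.prod_le_prod' fun i hi =>
        (hr i (Finset.mem_Icc.mp hi).1 (Finset.mem_Icc.mp hi).2 (e i)).2
    refine h1.trans ?_
    rw [Finset.prod_pow_eq_pow_sum]
    refine Ideal.pow_le_pow_right ?_
    have h2 : ∑ i ∈ T, p * (i - t + 1) * e i ≤ ∑ i ∈ T, (q * r i (e i) + C i) :=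
      Finset.sum_le_sum fun i hi =>
        (hr i (Finset.mem_Icc.mp hi).1 (Finset.mem_Icc.mp hi).2 (e i)).1
    rw [Finset.sum_add_distrib, ← Finset.mul_sum] at h2
    have h3 : ∑ i ∈ T, p * (i - t + 1) * e i = p * s := by
      rw [← he, Finset.mul_sum]
      exact Finset.sum_congr rfl fun i _ => by ring
    exact Nat.le_of_mul_le_mul_left (by omega) hq

/-! ### Degrees and powers of the irrelevant ideal. -/

theorem irrelevantIdeal_eq_idealOfVars (k σ : Type*) [Field k] :
    irrelevantIdeal k σ = MvPolynomial.idealOfVars σ k := rfl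

section
variable {k σ : Type*} [Field k]

theorem le_totalDegree_of_mem_irrelevantIdeal_pow {d : ℕ} {f : MvPolynomial σ k}
    (hf : f ∈ irrelevantIdeal k σ ^ d) (hf0 : f ≠ 0) : d ≤ f.totalDegree := by
  rw [irrelevantIdeal_eq_idealOfVars, MvPolynomial.mem_pow_idealOfVars_iff] at hf
  obtain ⟨x, hx⟩ := MvPolynomial.support_nonempty.mpr hf0
  exact (hf x hx).trans (MvPolynomial.le_totalDegree hx)

theorem MvPolynomial.IsHomogeneous.mem_irrelevantIdeal_pow {d : ℕ} {f : MvPolynomial σ k}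
    (hf : f.IsHomogeneous d) : f ∈ irrelevantIdeal k σ ^ d := by
  rw [irrelevantIdeal_eq_idealOfVars, MvPolynomial.mem_pow_idealOfVars_iff]
  intro x hx
  rw [Finsupp.degree_eq_weight_one]
  exact (hf (MvPolynomial.mem_support_iff.mp hx)).ge

theorem initialDegree_le_totalDegree {I : Ideal (MvPolynomial σ k)} {f : MvPolynomial σ k}
    (hf : f ∈ I) (hf0 : f ≠ 0) : initialDegree I ≤ f.totalDegree :=
  Nat.sInf_le ⟨f, hf, hf0, rfl⟩

theorem exists_totalDegree_eq_initialDegree {I : Ideal (MvPolynomial σ k)} (hI : I ≠ ⊥) :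
    ∃ f ∈ I, f ≠ 0 ∧ f.totalDegree = initialDegree I := by
  obtain ⟨f, hf, hf0⟩ := Submodule.exists_mem_ne_zero_of_ne_bot hI
  exact Nat.sInf_mem (s := {d | ∃ f ∈ I, f ≠ 0 ∧ f.totalDegree = d}) ⟨_, f, hf, hf0, rfl⟩

/-- Bounding degrees through powers of 𝔪 avoids having to know that symbolic powers are homogeneous.
-/
theorem le_initialDegree_of_le_irrelevantIdeal_pow {I : Ideal (MvPolynomial σ k)} (hI : I ≠ ⊥)
    {d : ℕ} (h : I ≤ irrelevantIdeal k σ ^ d) : d ≤ initialDegree I := by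
  obtain ⟨f, hf, hf0, hfd⟩ := exists_totalDegree_eq_initialDegree hI
  exact hfd ▸ le_totalDegree_of_mem_irrelevantIdeal_pow (h hf) hf0

theorem le_irrelevantIdeal_pow_initialDegree {I : Ideal (MvPolynomial σ k)}
    (hI : I.IsHomogeneous (MvPolynomial.homogeneousSubmodule σ k)) :
    I ≤ irrelevantIdeal k σ ^ initialDegree I := by
  intro f hf
  rw [← MvPolynomial.sum_homogeneousComponent f]
  refine sum_mem fun d _ => ?_
  by_cases h0 : MvPolynomial.homogeneousComponent d f = 0
  · rw [h0]
    exact zero_mem _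
  · have hd := MvPolynomial.homogeneousComponent_isHomogeneous d f
    refine Ideal.pow_le_pow_right ?_ hd.mem_irrelevantIdeal_pow
    rw [← hd.totalDegree h0]
    exact initialDegree_le_totalDegree (MvPolynomial.homogeneousComponent_mem_of_mem hI hf d) h0

/-! ### Ideals generated by linear forms. -/

theorem IsGeneratedByLinearForms.le_irrelevantIdeal {I : Ideal (MvPolynomial σ k)}
    (h : IsGeneratedByLinearForms I) : I ≤ irrelevantIdeal k σ := by
  obtain ⟨S, hS, rfl⟩ := h
  rw [Ideal.span_le]
  intro f hf
  simpa using (hS f hf).mem_irrelevantIdeal_pow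

theorem IsGeneratedByLinearForms.initialDegree_eq_one {I : Ideal (MvPolynomial σ k)}
    (h : IsGeneratedByLinearForms I) (hI : I ≠ ⊥) : initialDegree I = 1 := by
  refine le_antisymm ?_ (le_initialDegree_of_le_irrelevantIdeal_pow hI
    (by simpa using h.le_irrelevantIdeal))
  obtain ⟨S, hS, rfl⟩ := h
  obtain ⟨f, hf, hf0⟩ : ∃ f ∈ S, f ≠ 0 := by
    by_contra! hcon
    exact hI (Ideal.span_eq_bot.mpr hcon)
  rw [← (hS f hf).totalDegree hf0]
  exact initialDegree_le_totalDegree (Ideal.subset_span hf) hf0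

theorem MvPolynomial.IsHomogeneous.linearMap_eq {V : Type*} [AddCommGroup V] [Module k V]
    {f : MvPolynomial σ k} (hf : f.IsHomogeneous 1) {u v : MvPolynomial σ k →ₗ[k] V}
    (h : ∀ i, u (MvPolynomial.X i) = v (MvPolynomial.X i)) : u f = v f := by
  have hf' : f ∈ MvPolynomial.homogeneousSubmodule σ k 1 := hf
  rw [MvPolynomial.homogeneousSubmodule_one_eq_span_X] at hf'
  refine LinearMap.eqOn_span ?_ hf'
  rintro _ ⟨i, rfl⟩
  exact h i

theorem MvPolynomial.IsHomogeneous.aeval_X_add_C {f : MvPolynomial σ k} (hf : f.IsHomogeneous 1)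
    (p : σ → k) :
    MvPolynomial.aeval (fun i => MvPolynomial.X i + MvPolynomial.C (p i)) f =
      f + MvPolynomial.C (MvPolynomial.eval p f) := by
  have := hf.linearMap_eq
    (u := (MvPolynomial.aeval (R := k)
      fun i => (MvPolynomial.X i + MvPolynomial.C (p i) : MvPolynomial σ k)).toLinearMap)
    (v := LinearMap.id + (Algebra.linearMap k (MvPolynomial σ k)).comp
      (MvPolynomial.aeval (R := k) p).toLinearMap)
    fun i => by simp [MvPolynomial.algebraMap_eq]
  simpa [MvPolynomial.algebraMap_eq, MvPolynomial.aeval_eq_eval] using this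

/-- A non-zero ideal `P` generated by linear forms with `𝔪 ^ N * P ≤ P ^ (N + 1)` for some `N > 0`
is the irrelevant ideal. -/
theorem IsGeneratedByLinearForms.eq_irrelevantIdeal {P : Ideal (MvPolynomial σ k)}
    (h : IsGeneratedByLinearForms P) (hP : P ≠ ⊥) {N : ℕ} (hN : 0 < N)
    (hle : irrelevantIdeal k σ ^ N * P ≤ P ^ (N + 1)) : P = irrelevantIdeal k σ := by
  refine le_antisymm h.le_irrelevantIdeal ?_
  refine Ideal.span_le.mpr ?_
  rintro _ ⟨i, rfl⟩
  by_contra hi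
  obtain ⟨S, hS, rfl⟩ := h
  have hi' : (MvPolynomial.X i : MvPolynomial σ k) ∉ Submodule.span k S := fun hX =>
    hi (Submodule.span_le_restrictScalars k (MvPolynomial σ k) S hX)
  -- On linear forms `g` is evaluation at a point `p` where `S` vanishes and `X i` does not.
  -- Translation by `p` fixes `S` and makes `X i` a non-zero constant modulo 𝔪, so the hypothesis
  -- forces a non-zero linear form into 𝔪².
  obtain ⟨g, hg, hgS⟩ := Submodule.exists_le_ker_of_notMem hi'
  set p : σ → k := fun j => g (MvPolynomial.X j) with hp
  have heval : ∀ f : MvPolynomial σ k, f.IsHomogeneous 1 → MvPolynomial.eval p f = g f := by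
    intro f hf
    have := hf.linearMap_eq (u := (MvPolynomial.aeval (R := k) p).toLinearMap) (v := g)
      fun i => by simp [hp]
    simpa [MvPolynomial.aeval_eq_eval] using this
  let φ : MvPolynomial σ k →ₐ[k] MvPolynomial σ k :=
    MvPolynomial.aeval fun j => MvPolynomial.X j + MvPolynomial.C (p j)
  have hφ : ∀ f ∈ S, φ f = f := by
    intro f hf
    rw [(hS f hf).aeval_X_add_C p, heval f (hS f hf),
      LinearMap.mem_ker.mp (hgS (Submodule.subset_span hf)), map_zero, add_zero]
  have hφ1 : (Ideal.span S).map φ ≤ irrelevantIdeal k σ := by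
    rw [Ideal.map_span, Ideal.span_le]
    rintro _ ⟨f, hf, rfl⟩
    rw [hφ f hf]
    simpa using (hS f hf).mem_irrelevantIdeal_pow
  obtain ⟨f, hf, hf0⟩ : ∃ f ∈ S, f ≠ 0 := by
    by_contra! hcon
    exact hP (Ideal.span_eq_bot.mpr hcon)
  have hX : (MvPolynomial.X i : MvPolynomial σ k) ∈ irrelevantIdeal k σ :=
    Ideal.subset_span ⟨i, rfl⟩
  have hmem : MvPolynomial.X i ^ N * f ∈ Ideal.span S ^ (N + 1) :=
    hle (Ideal.mul_mem_mul (Ideal.pow_mem_pow hX N)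
      (Ideal.subset_span hf))
  have hmem2 : (MvPolynomial.X i + MvPolynomial.C (p i)) ^ N * f ∈ irrelevantIdeal k σ ^ 2 := by
    have h1 := Ideal.mem_map_of_mem φ hmem
    rw [Ideal.map_pow, map_mul, map_pow, hφ f hf] at h1
    have h2 := Ideal.pow_le_pow_right (show 2 ≤ N + 1 by omega) (Ideal.pow_right_mono hφ1 _ h1)
    simpa [φ] using h2
  have hfm : f ∈ irrelevantIdeal k σ := by simpa using (hS f hf).mem_irrelevantIdeal_pow
  obtain ⟨u, hu⟩ := sub_dvd_pow_sub_pow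
    (MvPolynomial.X i + MvPolynomial.C (p i) : MvPolynomial σ k) (MvPolynomial.C (p i)) N
  have hCf : MvPolynomial.C (p i ^ N) * f ∈ irrelevantIdeal k σ ^ 2 := by
    have h3 : MvPolynomial.X i * f * u ∈ irrelevantIdeal k σ ^ 2 :=
      Ideal.mul_mem_right _ _ (pow_two (irrelevantIdeal k σ) ▸ Ideal.mul_mem_mul hX hfm)
    have h4 : MvPolynomial.C (p i ^ N) * f =
        (MvPolynomial.X i + MvPolynomial.C (p i)) ^ N * f - MvPolynomial.X i * f * u := by
      rw [map_pow]
      linear_combination (-f) * hu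
    rw [h4]
    exact sub_mem hmem2 h3
  have hf2 : f ∈ irrelevantIdeal k σ ^ 2 := by
    have h5 := Ideal.mul_mem_left _ (MvPolynomial.C ((p i ^ N)⁻¹)) hCf
    rwa [← mul_assoc, ← map_mul, inv_mul_cancel₀ (pow_ne_zero _ hg), map_one, one_mul] at h5
  have := le_totalDegree_of_mem_irrelevantIdeal_pow hf2 hf0
  rw [(hS f hf).totalDegree hf0] at this
  omega

end

/-! ### Limits and asymptotic resurgence from bounds with bounded error. -/

theorem tendsto_div_of_mul_bounds {α : ℕ → ℕ} {m b C : ℕ} (hb : 0 < b)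
    (h₁ : ∀ s, m * s ≤ b * α s) (h₂ : ∀ s, b * α s ≤ m * s + C) :
    Tendsto (fun s : ℕ => (α s : ℝ) / (s : ℝ)) atTop (nhds ((m : ℝ) / b)) := by
  have hb' : (0 : ℝ) < b := by exact_mod_cast hb
  have hlim : Tendsto (fun s : ℕ => (m : ℝ) / b + (C / b : ℝ) / (s : ℝ)) atTop
      (nhds ((m : ℝ) / b)) := by
    simpa using tendsto_const_nhds.add (tendsto_const_div_atTop_nhds_zero_nat (C / b : ℝ))
  refine tendsto_of_tendsto_of_tendsto_of_le_of_le' tendsto_const_nhds hlim ?_ ?_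
  · filter_upwards [eventually_gt_atTop 0] with s hs
    have hs' : (0 : ℝ) < s := by exact_mod_cast hs
    rw [div_le_div_iff₀ hb' hs', mul_comm (α s : ℝ)]
    exact_mod_cast h₁ s
  · filter_upwards [eventually_gt_atTop 0] with s hs
    have hs' : (0 : ℝ) < s := by exact_mod_cast hs
    have h : (b : ℝ) * α s ≤ m * s + C := by exact_mod_cast h₂ s
    rw [div_le_iff₀ hs', add_mul, div_mul_cancel₀ _ hs'.ne', div_mul_eq_mul_div, ← add_div,
      le_div_iff₀ hb', mul_comm (α s : ℝ)]
    exact h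

/-- The asymptotic resurgence is `q / p` as soon as, up to bounded shifts, `A s ≤ B r` holds for
`q * r ≤ p * s` and fails for `q * r > p * s`. -/
theorem asymptoticResurgence_eq {R : Type*} [CommRing R] {A B : ℕ → Ideal R} {p q C C' : ℕ}
    (hp : 0 < p) (hq : 0 < q) (h₁ : ∀ s r, q * r + C ≤ p * s → A s ≤ B r)
    (h₂ : ∀ s r, p * s + C' < q * r → ¬ A s ≤ B r) :
    asymptoticResurgence A B = (((q : ℝ) / (p : ℝ) : ℝ) : EReal) := by
  have hp' : (0 : ℝ) < p := by exact_mod_cast hp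
  refine le_antisymm (sSup_le ?_) ?_
  · rintro _ ⟨s, r, hs, hr, hev, rfl⟩
    have hr' : (0 : ℝ) < r := by exact_mod_cast hr
    rw [EReal.coe_le_coe_iff, div_le_div_iff₀ hr' hp']
    by_contra! hlt
    have hlt' : q * r + 1 ≤ p * s := by
      rw [mul_comm p]
      exact_mod_cast hlt
    -- The integer gap of at least 1 is multiplied by k, so it absorbs `C` once k ≥ C.
    obtain ⟨k, hk, hkC⟩ := (hev.and (eventually_ge_atTop C)).exists
    refine hk (h₁ _ _ ?_)
    calc q * (r * k) + C ≤ (q * r + 1) * k := by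
          rw [add_mul, one_mul, mul_assoc]
          omega
      _ ≤ p * s * k := Nat.mul_le_mul_right k hlt'
      _ = p * (s * k) := mul_assoc _ _ _
  · have hlim : Tendsto (fun L : ℕ => (((q : ℝ) / p - (1 / p : ℝ) / (L : ℝ) : ℝ) : EReal)) atTop
        (nhds (((q : ℝ) / p : ℝ) : EReal)) := by
      refine (continuous_coe_real_ereal.tendsto _).comp ?_
      simpa using tendsto_const_nhds.sub (tendsto_const_div_atTop_nhds_zero_nat (1 / p : ℝ))
    refine le_of_tendsto hlim ?_
    filter_upwards [eventually_ge_atTop 2] with L hL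
    have hqL : 2 ≤ q * L := hL.trans (Nat.le_mul_of_pos_left L hq)
    have hL' : (0 : ℝ) < L := by exact_mod_cast (by omega : 0 < L)
    -- The ratio (qL - 1)/(pL) lies just below q/p; the resulting gap pk exceeds `C'` for large k.
    refine le_sSup ⟨q * L - 1, p * L, by omega, by positivity, ?_, ?_⟩
    · filter_upwards [eventually_gt_atTop C'] with k hk
      refine h₂ _ _ ?_
      obtain ⟨x, hx⟩ : ∃ x, q * L = x + 1 := ⟨q * L - 1, by omega⟩
      rw [hx, Nat.add_sub_cancel]
      calc p * (x * k) + C' < p * (x * k) + p * k :=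
            Nat.add_lt_add_left (hk.trans_le (Nat.le_mul_of_pos_left k hp)) _
        _ = p * ((x + 1) * k) := by ring
        _ = p * (q * L * k) := by rw [hx]
        _ = q * (p * L * k) := by ring
    · rw [EReal.coe_eq_coe_iff, Nat.cast_sub (by omega)]
      push_cast
      field_simp

/-! ### Degrees of symbolic powers, and their containment in powers of 𝔪^N a_t. -/

section
variable {k σ : Type*} [Field k] {m N : ℕ} {a : ℕ → Ideal (MvPolynomial σ k)} {t : ℕ}

theorem mul_le_initialDegree_symbolicPower
    (h : symbolicReesAlgebra (a t) = shiftedReesAlgebra a t m) (ht : 1 ≤ t) (htm : t ≤ m)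
    (hdeg : ∀ i, t ≤ i → i ≤ m → a i ≤ irrelevantIdeal k σ ^ i) {s : ℕ}
    (hs : symbolicPower (a t) s ≠ ⊥) :
    m * s ≤ (m - t + 1) * initialDegree (symbolicPower (a t) s) := by
  have hb : 0 < m - t + 1 := Nat.succ_pos _
  rw [← ceilDiv_le_iff_le_mul hb]
  refine le_initialDegree_of_le_irrelevantIdeal_pow hs ?_
  refine symbolicPower_le_of_symbolicReesAlgebra_eq h
    -- Subadditivity of the ceiling makes this a graded family.
    (fun s => irrelevantIdeal k σ ^ (m * s ⌈/⌉ (m - t + 1))) (by simp) ?_ ?_ s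
  · intro i j
    rw [← pow_add]
    refine Ideal.pow_le_pow_right ?_
    rw [ceilDiv_le_iff_le_mul hb, mul_add, mul_add]
    exact add_le_add ((ceilDiv_le_iff_le_mul hb).mp le_rfl)
      ((ceilDiv_le_iff_le_mul hb).mp le_rfl)
  · intro j htj hjm
    refine (hdeg j htj hjm).trans (Ideal.pow_le_pow_right ?_)
    rw [ceilDiv_le_iff_le_mul hb]
    obtain ⟨x, rfl⟩ := Nat.exists_eq_add_of_le htj
    obtain ⟨y, rfl⟩ := Nat.exists_eq_add_of_le hjm
    obtain ⟨z, rfl⟩ := Nat.exists_eq_add_of_le ht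
    rw [show 1 + z + x + y - (1 + z) + 1 = x + y + 1 by omega,
      show 1 + z + x - (1 + z) + 1 = x + 1 by omega]
    nlinarith [Nat.zero_le (z * y)]

theorem exists_mem_symbolicPower_totalDegree_le
    (h : symbolicReesAlgebra (a t) = shiftedReesAlgebra a t m) (ht : 1 ≤ t) (htm : t ≤ m)
    (hne : ∀ i, 1 ≤ i → i ≤ m → a i ≠ ⊥)
    (hdeg : ∀ i, 1 ≤ i → i ≤ m → initialDegree (a i) = i) (s : ℕ) :
    ∃ f ∈ symbolicPower (a t) s, f ≠ 0 ∧
      (m - t + 1) * f.totalDegree ≤ m * s + (m - t + 1) * (t * (m - t + 1)) := by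
  obtain ⟨f, hf, hf0, hfd⟩ := exists_totalDegree_eq_initialDegree (hne t ht htm)
  obtain ⟨g, hg, hg0, hgd⟩ := exists_totalDegree_eq_initialDegree (hne m (ht.trans htm) le_rfl)
  rw [hdeg t ht htm] at hfd
  rw [hdeg m (ht.trans htm) le_rfl] at hgd
  set b := m - t + 1 with hb
  have hb0 : 0 < b := Nat.succ_pos _
  -- `g` lies in the b-th symbolic power and has the best ratio m/b of degree to order; `f` only
  -- fills in the remainder of s modulo b.
  refine ⟨g ^ (s / b) * f ^ (s % b), ?_, mul_ne_zero (pow_ne_zero _ hg0) (pow_ne_zero _ hf0), ?_⟩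
  · have h1 := symbolicPower_pow_le (a t) _ (s / b)
      (Ideal.pow_mem_pow (le_symbolicPower_of_symbolicReesAlgebra_eq h htm le_rfl hg) (s / b))
    have h2 := symbolicPower_pow_le (a t) _ (s % b)
      (Ideal.pow_mem_pow (le_symbolicPower_of_symbolicReesAlgebra_eq h le_rfl htm hf) (s % b))
    have h3 := mul_mem_symbolicPower_add _ h1 h2
    rwa [Nat.sub_self, zero_add, one_mul, ← hb, Nat.div_add_mod] at h3
  · have h1 : (g ^ (s / b) * f ^ (s % b)).totalDegree ≤ s / b * m + s % b * t := by
      refine (MvPolynomial.totalDegree_mul _ _).trans ?_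
      rw [← hfd, ← hgd]
      exact add_le_add (MvPolynomial.totalDegree_pow _ _) (MvPolynomial.totalDegree_pow _ _)
    calc b * (g ^ (s / b) * f ^ (s % b)).totalDegree ≤ b * (s / b * m + s % b * t) :=
          Nat.mul_le_mul_left b h1
      _ = m * (b * (s / b)) + b * (t * (s % b)) := by ring
      _ ≤ m * s + b * (t * b) :=
          add_le_add (Nat.mul_le_mul_left m (Nat.mul_div_le s b))
            (Nat.mul_le_mul_left b (Nat.mul_le_mul_left t (Nat.mod_lt s hb0).le))

theorem exists_symbolicPower_le_irrelevantIdeal_mul_pow [Finite σ]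
    (hP1 : ∀ t, 1 ≤ t → t ≤ m → symbolicReesAlgebra (a t) = shiftedReesAlgebra a t m)
    (hle : ∀ i, 1 ≤ i → i ≤ m → a i ≤ a 1 ^ i)
    (ht : 1 ≤ t) (htm : t ≤ m)
    (hP3 : ∀ s, 1 ≤ s → idealIntegralClosure ((irrelevantIdeal k σ ^ N * a t) ^ s) =
        ((a 1 ^ (N * s + t * s) ⊓
          ⨅ j ∈ Finset.Icc 2 t, symbolicPower (a j) (s * (t - j + 1)) :
            Ideal (MvPolynomial σ k)) : Set (MvPolynomial σ k))) :
    ∃ C, ∀ s r, (N + t) * (m - t + 1) * r + C ≤ m * s →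
      symbolicPower (a t) s ≤ (irrelevantIdeal k σ ^ N * a t) ^ r := by
  set I := irrelevantIdeal k σ ^ N * a t with hI
  set E := (N + t) * (m - t + 1) with hE
  have hE0 : 0 < E := by positivity
  refine exists_symbolicPower_le_pow (hP1 t ht htm) I m hE0 fun i hti him => ?_
  set v := m * (i - t + 1) with hv
  have hv0 : 1 ≤ v := Nat.mul_pos (by omega) (Nat.succ_pos _)
  have hcl : ((a i ^ E : Ideal (MvPolynomial σ k)) : Set (MvPolynomial σ k)) ⊆
      idealIntegralClosure (I ^ v) := by
    rw [hP3 v hv0, SetLike.coe_subset_coe]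
    obtain ⟨x, rfl⟩ := Nat.exists_eq_add_of_le hti
    obtain ⟨y, rfl⟩ := Nat.exists_eq_add_of_le him
    rw [show t + x + y - t + 1 = x + y + 1 by omega] at hE
    rw [show t + x - t + 1 = x + 1 by omega] at hv
    refine le_inf ?_ (le_iInf₂ fun j hj => ?_)
    · refine (Ideal.pow_right_mono (hle _ (by omega) him) E).trans ?_
      rw [← pow_mul]
      refine Ideal.pow_le_pow_right ?_
      obtain ⟨z, rfl⟩ := Nat.exists_eq_add_of_le ht
      -- This is m(i-t+1) ≤ i(m-t+1); the two sides differ by (t-1)(m-i).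
      have h1 : (1 + z + x + y) * (x + 1) ≤ (1 + z + x) * (x + y + 1) := by
        nlinarith [Nat.zero_le (z * y)]
      rw [hv, hE, ← add_mul]
      calc (N + (1 + z)) * ((1 + z + x + y) * (x + 1))
          ≤ (N + (1 + z)) * ((1 + z + x) * (x + y + 1)) := Nat.mul_le_mul_left _ h1
        _ = (1 + z + x) * ((N + (1 + z)) * (x + y + 1)) := by ring
    · obtain ⟨hj2, hjt⟩ := Finset.mem_Icc.mp hj
      refine (Ideal.pow_right_mono (le_symbolicPower_of_symbolicReesAlgebra_eq
        (hP1 j (by omega) (by omega)) (by omega : j ≤ t + x) him) E).trans ?_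
      refine (symbolicPower_pow_le _ _ _).trans (symbolicPower_antitone _ ?_)
      obtain ⟨z, rfl⟩ := Nat.exists_eq_add_of_le hjt
      rw [show j + z - j + 1 = z + 1 by omega, show j + z + x - j + 1 = z + x + 1 by omega, hv, hE]
      obtain ⟨w, rfl⟩ := Nat.exists_eq_add_of_le hj2
      -- The required inequality is split through the factor m-j+1: `h1` is (i-t+1)(m-j+1) ≤
      -- (i-j+1)(m-t+1), and `h2` is m(t-j+1) ≤ (N+t)(m-j+1).
      have h1 : (x + 1) * (z + x + y + 1) ≤ (z + x + 1) * (x + y + 1) := by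
        nlinarith [Nat.zero_le (z * y)]
      have h2 : (2 + w + z + x + y) * (z + 1) ≤ (N + (2 + w + z)) * (z + x + y + 1) := by
        have : (2 + w + z + x + y) * (z + 1) ≤ (2 + w + z) * (z + x + y + 1) := by
          nlinarith [Nat.zero_le (w * x), Nat.zero_le (w * y)]
        exact this.trans (Nat.mul_le_mul_right _ (by omega))
      calc (2 + w + z + x + y) * (x + 1) * (z + 1)
          = (2 + w + z + x + y) * (z + 1) * (x + 1) := by ring
        _ ≤ (N + (2 + w + z)) * (z + x + y + 1) * (x + 1) := Nat.mul_le_mul_right _ h2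
        _ = (N + (2 + w + z)) * ((x + 1) * (z + x + y + 1)) := by ring
        _ ≤ (N + (2 + w + z)) * ((z + x + 1) * (x + y + 1)) := Nat.mul_le_mul_left _ h1
        _ = (z + x + 1) * ((N + (2 + w + z)) * (x + y + 1)) := by ring
  obtain ⟨c, hc⟩ := Ideal.FG.exists_pow_le_of_subset_idealIntegralClosure
    (IsNoetherian.noetherian (a i ^ E)) hcl
  -- Rounding e down to a multiple of E loses less than one block, and removing the integral closure
  -- loses at most c more.
  refine ⟨v * (E * (c + 1)), fun e => ⟨v * (e / E - c), ?_, ?_⟩⟩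
  · have h1 : e ≤ E * (e / E + 1) := (Nat.lt_mul_div_succ e hE0).le
    have h2 : E * (e / E + 1) ≤ E * ((e / E - c) + (c + 1)) := Nat.mul_le_mul_left E (by omega)
    calc v * e ≤ v * (E * ((e / E - c) + (c + 1))) := Nat.mul_le_mul_left v (h1.trans h2)
      _ = E * (v * (e / E - c)) + v * (E * (c + 1)) := by ring
  · calc a i ^ e ≤ a i ^ (E * (e / E)) := Ideal.pow_le_pow_right (Nat.mul_div_le e E)
      _ = (a i ^ E) ^ (e / E) := pow_mul _ _ _
      _ ≤ (I ^ v) ^ (e / E - c) := hc _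
      _ = I ^ (v * (e / E - c)) := (pow_mul _ _ _).symm

end

/-! ### The main theorem. -/

theorem mainTheorem3 {k : Type*} [Field k] (n m N : ℕ)
    (a : ℕ → Ideal (MvPolynomial (Fin n) k))
    (ha_hom : ∀ t, 1 ≤ t → t ≤ m →
      (a t).IsHomogeneous (MvPolynomial.homogeneousSubmodule (Fin n) k))
    (ha_ne_bot : ∀ t, 1 ≤ t → t ≤ m → a t ≠ ⊥)
    (ha_ne_top : ∀ t, 1 ≤ t → t ≤ m → a t ≠ ⊤)
    (hP1 : ∀ t, 1 ≤ t → t ≤ m → symbolicReesAlgebra (a t) = shiftedReesAlgebra a t m)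
    (hP2 : ∀ t, t < m → initialDegree (a (t + 1)) = initialDegree (a 1) + t)
    (hP3_lin : IsGeneratedByLinearForms (a 1))
    (hP3 : ∀ t, 1 ≤ t → t ≤ m → ∀ s, 1 ≤ s →
      idealIntegralClosure ((irrelevantIdeal k (Fin n) ^ N * a t) ^ s) =
        ((a 1 ^ (N * s + t * s) ⊓
          ⨅ j ∈ Finset.Icc 2 t, symbolicPower (a j) (s * (t - j + 1)) :
            Ideal (MvPolynomial (Fin n) k)) : Set (MvPolynomial (Fin n) k))) :
    ∀ t, 1 ≤ t → t ≤ m →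
      Tendsto (fun s : ℕ => (initialDegree (symbolicPower (a t) s) : ℝ) / (s : ℝ)) atTop
        (nhds (waldschmidtConstant (a t))) ∧
      asymptoticResurgence (fun i => symbolicPower (a t) i)
          (fun i => (irrelevantIdeal k (Fin n) ^ N * a t) ^ i) =
        ((((N : ℝ) + (initialDegree (a t) : ℝ)) / waldschmidtConstant (a t) : ℝ) : EReal) ∧
      ((N : ℝ) + (initialDegree (a t) : ℝ)) / waldschmidtConstant (a t) =
        ((N : ℝ) + (t : ℝ)) * ((m : ℝ) - (t : ℝ) + 1) / (m : ℝ) := by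
  intro t ht htm
  have hm : 1 ≤ m := ht.trans htm
  have hdeg : ∀ i, 1 ≤ i → i ≤ m → initialDegree (a i) = i := by
    intro i hi him
    obtain ⟨j, rfl⟩ := Nat.exists_eq_add_of_le' hi
    rw [hP2 j (by omega), hP3_lin.initialDegree_eq_one (ha_ne_bot 1 le_rfl hm), add_comm]
  have hpow : ∀ i, 1 ≤ i → i ≤ m → a i ≤ irrelevantIdeal k (Fin n) ^ i := fun i hi him => by
    simpa only [hdeg i hi him] using le_irrelevantIdeal_pow_initialDegree (ha_hom i hi him)
  have hmul : ∀ i, 1 ≤ i → i ≤ m → irrelevantIdeal k (Fin n) ^ N * a i ≤ a 1 ^ (N + i) := by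
    intro i hi him f hf
    have h := le_idealIntegralClosure _ ((pow_one (irrelevantIdeal k (Fin n) ^ N * a i)).symm ▸ hf)
    rw [hP3 i hi him 1 le_rfl] at h
    simpa using h.1
  have hle : ∀ i, 1 ≤ i → i ≤ m → a i ≤ a 1 ^ i := by
    intro i hi him
    rcases Nat.eq_zero_or_pos N with hN | hN
    · simpa [hN] using hmul i hi him
    -- For N > 0, the case i = 1 of `hmul` forces a_1 = 𝔪, and the degree bound suffices.
    · rw [hP3_lin.eq_irrelevantIdeal (ha_ne_bot 1 le_rfl hm) hN (hmul 1 le_rfl hm)]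
      exact hpow i hi him
  set b := m - t + 1 with hb
  have hb0 : 0 < b := Nat.succ_pos _
  have hE0 : 0 < (N + t) * b := Nat.mul_pos (by omega) hb0
  have hsmall := exists_mem_symbolicPower_totalDegree_le (hP1 t ht htm) ht htm ha_ne_bot hdeg
  have hne : ∀ s, symbolicPower (a t) s ≠ ⊥ := fun s => by
    obtain ⟨f, hf, hf0, -⟩ := hsmall s
    exact Submodule.ne_bot_iff _ |>.mpr ⟨f, hf, hf0⟩
  have hlim : Tendsto (fun s : ℕ => (initialDegree (symbolicPower (a t) s) : ℝ) / (s : ℝ)) atTop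
      (nhds ((m : ℝ) / b)) := by
    refine tendsto_div_of_mul_bounds hb0 (C := b * (t * b)) (fun s =>
      mul_le_initialDegree_symbolicPower (hP1 t ht htm) ht htm
        (fun i hi => hpow i (ht.trans hi)) (hne s)) fun s => ?_
    obtain ⟨f, hf, hf0, hfd⟩ := hsmall s
    exact (Nat.mul_le_mul_left b (initialDegree_le_totalDegree hf hf0)).trans hfd
  have hW : waldschmidtConstant (a t) = (m : ℝ) / b := hlim.limUnder_eq
  have hfrac : ((N : ℝ) + (initialDegree (a t) : ℝ)) / waldschmidtConstant (a t) =
      (((N + t) * b : ℕ) : ℝ) / (m : ℝ) := by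
    rw [hW, hdeg t ht htm, div_div_eq_mul_div]
    push_cast
    rfl
  refine ⟨hW ▸ hlim, ?_, ?_⟩
  · obtain ⟨C, hC⟩ := exists_symbolicPower_le_irrelevantIdeal_mul_pow hP1 hle ht htm
      (hP3 t ht htm)
    rw [hfrac]
    refine asymptoticResurgence_eq (C' := b * (t * b)) hm hE0 hC fun s r hsr hsub => ?_
    -- An element of nearly minimal degree in the symbolic power has degree too small for
    -- 𝔪^((N+t)r).
    obtain ⟨f, hf, hf0, hfd⟩ := hsmall s
    have hI : irrelevantIdeal k (Fin n) ^ N * a t ≤ irrelevantIdeal k (Fin n) ^ (N + t) := by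
      rw [pow_add]
      exact Ideal.mul_mono_right (hpow t ht htm)
    have hf' := Ideal.pow_right_mono hI r (hsub hf)
    rw [← pow_mul] at hf'
    have h1 := Nat.mul_le_mul_left b (le_totalDegree_of_mem_irrelevantIdeal_pow hf' hf0)
    rw [show b * ((N + t) * r) = (N + t) * b * r by ring] at h1
    exact absurd (h1.trans hfd) hsr.not_ge
  · rw [hfrac, hb]
    push_cast [Nat.cast_sub htm]
    rfl
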